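/- For a positive integer $r$, let $N_3(0,r)$ denote the number of triples $(x_1,x_2,x_3)\in(\mathbb{Z}/r\mathbb{Z})^3$ with $x_1^2+x_2^2+x_3^2= 0$ in $\mathbb{Z}/r\mathbb{Z}$, i.e. the number of incongruent solutions of $x_1^2+x_2^2+x_3^2\equiv 0 \pmod r$. Then, as the real variable $x$ tends to infinity, $$\sum_{1\le r\le x} N_3(0,r)=\frac{24\,\zeta(3)}{\pi^4}\,x^3+O(x^2\log x),$$ where the sum is over integers $r$ and $\zeta$ is the Riemann zeta function. -/

import Mathlib

/-- The number `N_k(n, r)` of incongruent solutions `(x₁, …, x_k)` of the congruence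
`x₁² + ⋯ + x_k² ≡ n (mod r)`, that is, of solutions in the residue class ring `ℤ/rℤ`.
It is meaningful for `r ≥ 1`. -/
noncomputable def numSqSolutions (k : ℕ) (n : ℤ) (r : ℕ) : ℕ :=
  Nat.card {x : Fin k → ZMod r // ∑ i, x i ^ 2 = (n : ZMod r)}

/-!
Write `N r` for the number of zeros of `x₁² + x₂² + x₃²` modulo `r`. The proof rests on the
exact formula `N r = r² ∑_{d² ∣ r} h d`, where `h d = φ(d) / d²` for odd `d` and
`h d = -2 φ(d) / d²` for even `d` (`solutionDensity_eq`, `numSqSolutions_three_eq_sum`).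

Both sides of the formula are multiplicative, so prime powers suffice, and there both sides satisfy
the same two-step recursion. For odd `p` the zeros modulo `p ^ (a + 2)` split into the primitive
ones, which are the lifts of the `p² - 1` nonzero zeros modulo `p`, with `p ^ (2 (a + 1))` lifts
each (`card_lifts_of_ne_zero`), and the multiples of `p`, of which there are `p³ N (p ^ a)`
(`card_imprimitive`). That `N p = p²` follows from the vanishing of a quadratic character sum
(`sum_quadraticChar_add_sq`). Modulo a multiple of `4` there are no primitive zeros, whence
`N (4 r) = 8 N r`.

Summing over `r ≤ x` and exchanging the sums gives `∑_d h d ∑_{r ≤ x, d² ∣ r} r²`. The inner sum is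
`x³ / (3 d²) + O(x²)` uniformly in `d` (`abs_sum_sq_dvd_sub_le`), and `|h d| ≤ 2 / d`, so the total
error is `O(x²)` times a harmonic sum, while completing the series `∑ h d / d²` costs `O(x²)`.
The value of the series follows from `∑ φ(d) / d⁴ = ζ(3) / ζ(4)` and `ζ(4) = π⁴ / 90`, after the
even and odd `d` are separated (`tsum_squareCoeff_div_sq`).
-/

/-! ### Counting by fibres and the Chinese remainder theorem -/

theorem numSqSolutions_zero (k r : ℕ) :
    numSqSolutions k 0 r = Nat.card {x : Fin k → ZMod r // ∑ i, x i ^ 2 = 0} := by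
  simp [numSqSolutions]

theorem Nat.card_eq_mul_of_card_fiber {A B : Type*} [Finite A] [Finite B] (f : A → B) (c : ℕ)
    (h : ∀ b, Nat.card {a // f a = b} = c) : Nat.card A = c * Nat.card B := by
  have := Fintype.ofFinite B
  rw [← Nat.card_congr (Equiv.sigmaFiberEquiv f), Nat.card_sigma]
  simp [h, mul_comm]

theorem ZMod.card_fiber_castHom {m n : ℕ} [NeZero n] (h : m ∣ n) (y : ZMod m) :
    Nat.card {x : ZMod n // ZMod.castHom h (ZMod m) x = y} = n / m := by
  have hm : NeZero m := ⟨fun h0 => NeZero.ne n (Nat.eq_zero_of_zero_dvd (h0 ▸ h))⟩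
  have key : ∀ y : ZMod m, Nat.card {x : ZMod n // ZMod.castHom h (ZMod m) x = y}
      = Nat.card {x : ZMod n // ZMod.castHom h (ZMod m) x = 0} := by
    intro y
    obtain ⟨x₀, hx₀⟩ := ZMod.castHom_surjective h y
    refine Nat.card_congr ((Equiv.subRight x₀).subtypeEquiv fun x => ?_)
    simp only [Equiv.subRight_apply, map_sub, hx₀, sub_eq_zero]
  have := Nat.card_eq_mul_of_card_fiber (ZMod.castHom h (ZMod m)) _ key
  rw [Nat.card_zmod, Nat.card_zmod] at this
  rw [key y]
  exact (Nat.div_eq_of_eq_mul_left (NeZero.pos m) this).symm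

/-- A condition on tuples over `ZMod n` that only depends on the residues modulo `m ∣ n` has
`(n / m) ^ k` solutions over each solution modulo `m`. -/
theorem ZMod.card_pi_castHom {m n : ℕ} [NeZero n] (h : m ∣ n) (k : ℕ)
    (P : (Fin k → ZMod m) → Prop) :
    Nat.card {x : Fin k → ZMod n // P fun i => ZMod.castHom h (ZMod m) (x i)}
      = (n / m) ^ k * Nat.card {y : Fin k → ZMod m // P y} := by
  have hm : NeZero m := ⟨fun h0 => NeZero.ne n (Nat.eq_zero_of_zero_dvd (h0 ▸ h))⟩
  refine Nat.card_eq_mul_of_card_fiber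
    (fun x => (⟨fun i => ZMod.castHom h (ZMod m) (x.1 i), x.2⟩ :
      {y : Fin k → ZMod m // P y})) _ fun y => ?_
  have e : {x : {x : Fin k → ZMod n // P fun i => ZMod.castHom h (ZMod m) (x i)} //
      (⟨fun i => ZMod.castHom h (ZMod m) (x.1 i), x.2⟩ : {y : Fin k → ZMod m // P y}) = y}
      ≃ ((i : Fin k) → {x : ZMod n // ZMod.castHom h (ZMod m) x = y.1 i}) :=
    { toFun := fun x i => ⟨x.1.1 i, congrFun (congrArg Subtype.val x.2) i⟩
      invFun := fun x => ⟨⟨fun i => (x i).1, by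
        have : (fun i => ZMod.castHom h (ZMod m) (x i).1) = y.1 := funext fun i => (x i).2
        rw [this]; exact y.2⟩, Subtype.ext (funext fun i => (x i).2)⟩
      left_inv := fun x => rfl
      right_inv := fun x => rfl }
  rw [Nat.card_congr e, Nat.card_pi]
  simp only [ZMod.card_fiber_castHom]
  simp

theorem numSqSolutions_mul (k : ℕ) {r s : ℕ} (h : r.Coprime s) :
    numSqSolutions k 0 (r * s) = numSqSolutions k 0 r * numSqSolutions k 0 s := by
  simp only [numSqSolutions_zero]
  rw [← Nat.card_prod]
  let e : (Fin k → ZMod (r * s)) ≃ (Fin k → ZMod r) × (Fin k → ZMod s) :=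
    (Equiv.piCongrRight fun _ => (ZMod.chineseRemainder h).toEquiv).trans
      (Equiv.arrowProdEquivProdArrow _ _ _)
  refine Nat.card_congr ((e.subtypeEquiv
    (q := fun z => ∑ i, z.1 i ^ 2 = 0 ∧ ∑ i, z.2 i ^ 2 = 0) fun x => ?_).trans
    (Equiv.subtypeProdEquivProd (p := fun x : Fin k → ZMod r => ∑ i, x i ^ 2 = 0)
      (q := fun x : Fin k → ZMod s => ∑ i, x i ^ 2 = 0)))
  rw [← (ZMod.chineseRemainder h).map_eq_zero_iff, map_sum, Prod.ext_iff, Prod.fst_sum,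
    Prod.snd_sum]
  simp [e]

/-! ### Imprimitive solutions -/

/-- The solutions modulo `q² r` all of whose coordinates are divisible by `q`: writing `x = q y`
with `y` modulo `q r`, the condition on `y` only depends on `y` modulo `r`. -/
theorem card_imprimitive (k : ℕ) {q r : ℕ} (hq : q ≠ 0) (hr : r ≠ 0) (hd : q ∣ q ^ 2 * r) :
    Nat.card {x : Fin k → ZMod (q ^ 2 * r) //
      ∑ i, x i ^ 2 = 0 ∧ ∀ i, ZMod.castHom hd (ZMod q) (x i) = 0}
      = q ^ k * numSqSolutions k 0 r := by
  have : NeZero (q * r) := ⟨mul_ne_zero hq hr⟩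
  have : NeZero (q ^ 2 * r) := ⟨mul_ne_zero (pow_ne_zero _ hq) hr⟩
  have hrq : r ∣ q * r := dvd_mul_left _ _
  rw [numSqSolutions_zero]
  have h1 := ZMod.card_pi_castHom hrq k (fun y => ∑ i, y i ^ 2 = 0)
  rw [Nat.mul_div_cancel _ (Nat.pos_of_ne_zero hr)] at h1
  rw [← h1]
  symm
  have hsq : ∀ y : Fin k → ZMod (q * r), (∑ i, (ZMod.castHom hrq (ZMod r) (y i)) ^ 2 = 0) ↔
      ∑ i, (((q * (y i).val : ℕ) : ZMod (q ^ 2 * r))) ^ 2 = 0 := by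
    intro y
    have e1 : ∑ i, (ZMod.castHom hrq (ZMod r) (y i)) ^ 2
        = ((∑ i, (y i).val ^ 2 : ℕ) : ZMod r) := by
      push_cast
      refine Finset.sum_congr rfl fun i _ => ?_
      conv_lhs => rw [← ZMod.natCast_zmod_val (y i), map_natCast]
    have e2 : ∑ i, (((q * (y i).val : ℕ) : ZMod (q ^ 2 * r))) ^ 2
        = ((q ^ 2 * ∑ i, (y i).val ^ 2 : ℕ) : ZMod (q ^ 2 * r)) := by
      push_cast
      rw [Finset.mul_sum]
      exact Finset.sum_congr rfl fun i _ => by ring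
    rw [e1, e2, ZMod.natCast_eq_zero_iff, ZMod.natCast_eq_zero_iff,
      mul_dvd_mul_iff_left (pow_ne_zero 2 hq)]
  refine Nat.card_eq_of_bijective
    (fun y => ⟨fun i => ((q * (y.1 i).val : ℕ) : ZMod (q ^ 2 * r)), (hsq y.1).1 y.2, fun i => by
      rw [map_natCast]; simp⟩) ⟨?_, ?_⟩
  · intro a b hab
    refine Subtype.ext (funext fun i => ?_)
    have := congrFun (congrArg Subtype.val hab) i
    simp only [] at this
    rw [ZMod.natCast_eq_natCast_iff, pow_two, mul_assoc] at this
    have := Nat.ModEq.mul_left_cancel' hq this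
    rw [← ZMod.natCast_eq_natCast_iff] at this
    simpa using this
  · rintro ⟨x, hx, hx0⟩
    have hval : ∀ i, q ∣ (x i).val := fun i => by
      have := hx0 i
      rw [← ZMod.natCast_zmod_val (x i), map_natCast, ZMod.natCast_eq_zero_iff] at this
      exact this
    choose t ht using hval
    have hx' : ∀ i, ((q * ((t i : ZMod (q * r))).val : ℕ) : ZMod (q ^ 2 * r)) = x i := by
      intro i
      conv_rhs => rw [← ZMod.natCast_zmod_val (x i), ht i]
      rw [ZMod.natCast_eq_natCast_iff, pow_two, mul_assoc]
      refine Nat.ModEq.mul_left' q ?_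
      rw [ZMod.val_natCast]
      exact Nat.mod_modEq _ _
    refine ⟨⟨fun i => (t i : ZMod (q * r)), ?_⟩, ?_⟩
    · refine (hsq _).2 ?_
      simp only [hx']
      exact hx
    · exact Subtype.ext (funext hx')

/-! ### Powers of two -/

theorem numSqSolutions_three_four_mul {r : ℕ} (hr : r ≠ 0) :
    numSqSolutions 3 0 (2 ^ 2 * r) = 8 * numSqSolutions 3 0 r := by
  have hd : 2 ∣ 2 ^ 2 * r := ⟨2 * r, by ring⟩
  have hd4 : 4 ∣ 2 ^ 2 * r := ⟨r, by ring⟩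
  rw [show 8 = 2 ^ 3 by rfl, ← card_imprimitive 3 two_ne_zero hr hd, numSqSolutions_zero]
  refine Nat.card_congr (Equiv.subtypeEquivRight fun x => ?_)
  refine ⟨fun h => ⟨h, ?_⟩, fun h => h.1⟩
  -- squares modulo `4` are `0` and `1`, so three of them add up to `0` only if all vanish
  have key : ∀ y : Fin 3 → ZMod 4, ∑ i, y i ^ 2 = 0 →
      ∀ i, ZMod.castHom (by norm_num : 2 ∣ 4) (ZMod 2) (y i) = 0 := by decide
  have h4 : ∑ i, (ZMod.castHom hd4 (ZMod 4) (x i)) ^ 2 = 0 := by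
    have := congrArg (ZMod.castHom hd4 (ZMod 4)) h
    simpa only [map_sum, map_pow, map_zero] using this
  intro i
  rw [← key _ h4 i, ← RingHom.comp_apply]
  congr 1
  exact Subsingleton.elim _ _

theorem numSqSolutions_three_two : numSqSolutions 3 0 2 = 4 := by
  rw [numSqSolutions_zero, Nat.card_eq_fintype_card]
  decide

theorem numSqSolutions_one (k : ℕ) : numSqSolutions k 0 1 = 1 := by
  rw [numSqSolutions_zero, Nat.card_eq_one_iff_unique]
  exact ⟨inferInstance, ⟨⟨0, Subsingleton.elim _ _⟩⟩⟩

/-! ### Primitive solutions modulo powers of an odd prime -/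

/-- Hensel's lemma for the square root of a unit: an element of `ZMod (p ^ (a + 1))`, `p` odd,
whose reduction is the square of `b ≠ 0` has exactly one square root that reduces to `b`. -/
theorem ZMod.existsUnique_sqrt_lift {p : ℕ} [hp : Fact p.Prime] (hp2 : p ≠ 2) {a : ℕ}
    (hd : p ∣ p ^ (a + 1)) (c : ZMod (p ^ (a + 1))) (b : ZMod p) (hb : b ≠ 0)
    (hbc : b ^ 2 = ZMod.castHom hd (ZMod p) c) :
    ∃! x : ZMod (p ^ (a + 1)), x ^ 2 = c ∧ ZMod.castHom hd (ZMod p) x = b := by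
  have hne : NeZero (p ^ (a + 1)) := ⟨pow_ne_zero _ hp.out.ne_zero⟩
  have h2 : (2 : ZMod p) ≠ 0 := by
    have := ZMod.prime_ne_zero p 2 hp2
    exact_mod_cast this
  set f := ZMod.castHom hd (ZMod p) with hf
  have hunit : ∀ z, f z ≠ 0 → IsUnit z := by
    intro z hz
    rw [← ZMod.natCast_zmod_val z, map_natCast, Ne, ZMod.natCast_eq_zero_iff] at hz
    rw [← ZMod.natCast_zmod_val z, ZMod.isUnit_iff_coprime]
    exact (Nat.Coprime.pow_left _ ((Nat.Prime.coprime_iff_not_dvd hp.out).2 hz)).symm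
  have hdvd : ∀ z, f z = 0 → (p : ZMod (p ^ (a + 1))) ∣ z := by
    intro z hz
    rw [← ZMod.natCast_zmod_val z, map_natCast, ZMod.natCast_eq_zero_iff] at hz
    rw [← ZMod.natCast_zmod_val z]
    exact Nat.cast_dvd_cast hz
  have hfp : f p = 0 := by rw [map_natCast]; simp
  have hp0 : (p : ZMod (p ^ (a + 1))) ^ (a + 1) = 0 := by
    have := ZMod.natCast_self (p ^ (a + 1))
    exact_mod_cast this
  -- Newton iteration; at `j = a` the divisor `p ^ (a + 1)` is `0`
  have hex : ∀ j : ℕ, ∃ x, f x = b ∧ (p : ZMod (p ^ (a + 1))) ^ (j + 1) ∣ x ^ 2 - c := by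
    intro j
    induction j with
    | zero =>
      obtain ⟨x, hx⟩ := ZMod.castHom_surjective hd b
      refine ⟨x, hx, ?_⟩
      rw [zero_add, pow_one]
      apply hdvd
      rw [map_sub, map_pow, hf, hx, hbc, hf, sub_self]
    | succ j ih =>
      obtain ⟨x, hx, t, ht⟩ := ih
      have hu : IsUnit (2 * x) := hunit _ (by
        rw [map_mul, hx, map_ofNat]; exact mul_ne_zero h2 hb)
      obtain ⟨u, hu⟩ := hu.exists_right_inv
      refine ⟨x - p ^ (j + 1) * t * u, ?_, p ^ j * (t * u) ^ 2, ?_⟩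
      · rw [map_sub, map_mul, map_mul, map_pow, hfp, hx]; simp
      · linear_combination ht - (p : ZMod (p ^ (a + 1))) ^ (j + 1) * t * hu
  obtain ⟨x, hx, hxd⟩ := hex a
  rw [hp0, zero_dvd_iff, sub_eq_zero] at hxd
  refine ⟨x, ⟨hxd, hx⟩, ?_⟩
  rintro y ⟨hyc, hy⟩
  have hu : IsUnit (y + x) := hunit _ (by
    rw [map_add, hx, hy, ← two_mul]; exact mul_ne_zero h2 hb)
  have h0 : (y + x) * (y - x) = 0 := by linear_combination hyc - hxd
  exact sub_eq_zero.1 ((hu.mul_right_eq_zero).1 h0)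

/-- Every nonzero solution in `k + 1` variables modulo an odd prime `p` has `(p ^ a) ^ k` lifts to
a solution modulo `p ^ (a + 1)`: all coordinates but one that is a unit lift freely, and then that one lifts
uniquely. -/
theorem card_lifts_of_ne_zero {p : ℕ} [hp : Fact p.Prime] (hp2 : p ≠ 2) {a k : ℕ}
    (hd : p ∣ p ^ (a + 1)) (y : Fin (k + 1) → ZMod p) (hy : ∑ i, y i ^ 2 = 0) (hy0 : y ≠ 0) :
    Nat.card {x : Fin (k + 1) → ZMod (p ^ (a + 1)) //
      ∑ i, x i ^ 2 = 0 ∧ (fun i => ZMod.castHom hd (ZMod p) (x i)) = y} = (p ^ a) ^ k := by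
  have hne : NeZero (p ^ (a + 1)) := ⟨pow_ne_zero _ hp.out.ne_zero⟩
  obtain ⟨i, hi⟩ := Function.ne_iff.1 hy0
  have hcard : Nat.card ((j : Fin k) → {z : ZMod (p ^ (a + 1)) //
      ZMod.castHom hd (ZMod p) z = y (i.succAbove j)}) = (p ^ a) ^ k := by
    rw [Nat.card_pi]
    simp only [ZMod.card_fiber_castHom]
    rw [pow_succ, Nat.mul_div_cancel _ hp.out.pos]
    simp
  rw [← hcard]
  refine Nat.card_eq_of_bijective
    (fun x j => ⟨x.1 (i.succAbove j), congrFun x.2.2 (i.succAbove j)⟩) ⟨?_, ?_⟩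
  · rintro ⟨x, hx, hxy⟩ ⟨x', hx', hxy'⟩ h
    have h' : ∀ j, x (i.succAbove j) = x' (i.succAbove j) := fun j =>
      congrArg Subtype.val (congrFun h j)
    rw [Fin.sum_univ_succAbove _ i] at hx hx' hy
    refine Subtype.ext (funext fun j => ?_)
    rcases Fin.eq_self_or_eq_succAbove i j with rfl | ⟨j, rfl⟩
    · refine (ZMod.existsUnique_sqrt_lift hp2 hd (-∑ l, x (j.succAbove l) ^ 2) (y j) hi ?_).unique
        ⟨eq_neg_of_add_eq_zero_left hx, congrFun hxy j⟩
        ⟨?_, congrFun hxy' j⟩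
      · rw [eq_neg_of_add_eq_zero_left hy, map_neg, map_sum]
        simp only [map_pow, ← hxy]
      · simp only [h']
        exact eq_neg_of_add_eq_zero_left hx'
    · exact h' j
  · intro z
    rw [Fin.sum_univ_succAbove _ i] at hy
    obtain ⟨w, ⟨hw, hwy⟩, -⟩ := ZMod.existsUnique_sqrt_lift hp2 hd (-∑ l, (z l).1 ^ 2) (y i) hi (by
      rw [eq_neg_of_add_eq_zero_left hy, map_neg, map_sum]
      simp only [map_pow, (z _).2])
    refine ⟨⟨i.insertNth w fun l => (z l).1, ?_, ?_⟩, ?_⟩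
    · rw [Fin.sum_univ_succAbove _ i]
      simp [hw]
    · funext j
      rcases Fin.eq_self_or_eq_succAbove i j with rfl | ⟨j, rfl⟩
      · simpa using hwy
      · simpa using (z j).2
    · funext j
      exact Subtype.ext (by simp)

theorem Nat.card_subtype_split {A : Type*} [Finite A] (P Q : A → Prop) :
    Nat.card {a // P a} = Nat.card {a // P a ∧ Q a} + Nat.card {a // P a ∧ ¬ Q a} := by
  classical
  rw [← Nat.card_sum]
  refine Nat.card_congr ((Equiv.sumCompl fun a : {a // P a} => Q a.1).symm.trans ?_)
  exact Equiv.sumCongr (Equiv.subtypeSubtypeEquivSubtypeInter P Q)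
    (Equiv.subtypeSubtypeEquivSubtypeInter P fun a => ¬ Q a)

theorem card_primitive {p : ℕ} [hp : Fact p.Prime] (hp2 : p ≠ 2) (a k : ℕ)
    (hd : p ∣ p ^ (a + 1)) :
    Nat.card {x : Fin (k + 1) → ZMod (p ^ (a + 1)) //
      ∑ i, x i ^ 2 = 0 ∧ ¬ ∀ i, ZMod.castHom hd (ZMod p) (x i) = 0}
      = (p ^ a) ^ k * (numSqSolutions (k + 1) 0 p - 1) := by
  have hne : NeZero (p ^ (a + 1)) := ⟨pow_ne_zero _ hp.out.ne_zero⟩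
  have hcard : Nat.card {y : Fin (k + 1) → ZMod p // ∑ i, y i ^ 2 = 0 ∧ ¬ y = 0}
      = numSqSolutions (k + 1) 0 p - 1 := by
    rw [numSqSolutions_zero, Nat.card_subtype_split
      (fun y : Fin (k + 1) → ZMod p => ∑ i, y i ^ 2 = 0) (fun y => y = 0)]
    have : Nat.card {y : Fin (k + 1) → ZMod p // ∑ i, y i ^ 2 = 0 ∧ y = 0} = 1 := by
      rw [Nat.card_eq_one_iff_unique]
      refine ⟨⟨fun s t => Subtype.ext (s.2.2.trans t.2.2.symm)⟩, ⟨0, by simp, rfl⟩⟩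
    omega
  rw [← hcard]
  refine Nat.card_eq_mul_of_card_fiber (fun x => ⟨fun i => ZMod.castHom hd (ZMod p) (x.1 i), by
    simpa only [map_sum, map_pow, map_zero] using congrArg (ZMod.castHom hd (ZMod p)) x.2.1,
    fun h => x.2.2 (congrFun h)⟩) _ fun y => ?_
  · rw [← card_lifts_of_ne_zero hp2 hd y.1 y.2.1 y.2.2]
    exact Nat.card_congr
      { toFun := fun x => ⟨x.1.1, x.1.2.1, congrArg Subtype.val x.2⟩
        invFun := fun x => ⟨⟨x.1, x.2.1, fun h => y.2.2 (x.2.2.symm.trans (funext h))⟩,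
          Subtype.ext x.2.2⟩
        left_inv := fun _ => rfl
        right_inv := fun _ => rfl }

/-! ### Solutions modulo an odd prime -/

/-- Multiplication by `α + β √-1` with `α² + β²` a nonsquare permutes the pairs and changes the
sign of `χ (x² + y²)`, so this sum vanishes. -/
theorem sum_quadraticChar_add_sq {p : ℕ} [hp : Fact p.Prime] (hp2 : p ≠ 2) :
    ∑ z : ZMod p × ZMod p, quadraticChar (ZMod p) (-(z.1 ^ 2 + z.2 ^ 2)) = 0 := by
  have hchar : ringChar (ZMod p) ≠ 2 := by rwa [ZMod.ringChar_zmod_n]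
  obtain ⟨g, hg⟩ := quadraticChar_exists_neg_one hchar
  obtain ⟨α, β, hαβ⟩ := ZMod.sq_add_sq p g
  have hg0 : g ≠ 0 := by rintro rfl; simp at hg
  let φ : ZMod p × ZMod p → ZMod p × ZMod p := fun z => (α * z.1 - β * z.2, α * z.2 + β * z.1)
  have hφ : Function.Bijective φ := by
    refine Finite.injective_iff_bijective.1 fun z w h => ?_
    have h1 := congrArg Prod.fst h
    have h2 := congrArg Prod.snd h
    simp only [φ] at h1 h2
    refine Prod.ext (mul_left_cancel₀ hg0 ?_) (mul_left_cancel₀ hg0 ?_)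
    · rw [← hαβ]; linear_combination α * h1 + β * h2
    · rw [← hαβ]; linear_combination α * h2 - β * h1
  have key := Function.Bijective.sum_comp hφ
    fun z => quadraticChar (ZMod p) (-(z.1 ^ 2 + z.2 ^ 2))
  have hneg : ∀ z, quadraticChar (ZMod p) (-((φ z).1 ^ 2 + (φ z).2 ^ 2))
      = - quadraticChar (ZMod p) (-(z.1 ^ 2 + z.2 ^ 2)) := by
    intro z
    rw [show -((φ z).1 ^ 2 + (φ z).2 ^ 2) = g * -(z.1 ^ 2 + z.2 ^ 2) by
      rw [← hαβ]; simp only [φ]; ring, map_mul, hg, neg_one_mul]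
  simp only [hneg, Finset.sum_neg_distrib] at key
  omega

theorem numSqSolutions_three_prime {p : ℕ} [hp : Fact p.Prime] (hp2 : p ≠ 2) :
    numSqSolutions 3 0 p = p ^ 2 := by
  have hchar : ringChar (ZMod p) ≠ 2 := by rwa [ZMod.ringChar_zmod_n]
  have e : {x : Fin 3 → ZMod p // ∑ i, x i ^ 2 = 0}
      ≃ (z : ZMod p × ZMod p) × {w : ZMod p // w ^ 2 = -(z.1 ^ 2 + z.2 ^ 2)} :=
    { toFun := fun x => ⟨(x.1 0, x.1 1), x.1 2, by
        have := x.2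
        rw [Fin.sum_univ_three] at this
        linear_combination this⟩
      invFun := fun z => ⟨![z.1.1, z.1.2, z.2.1], by
        have := z.2.2
        rw [Fin.sum_univ_three]
        simp [this]⟩
      left_inv := fun x => Subtype.ext (funext fun i => by fin_cases i <;> rfl)
      right_inv := fun z => rfl }
  rw [numSqSolutions_zero, Nat.card_congr e, Nat.card_sigma]
  have h1 : ∀ z : ZMod p × ZMod p,
      (Nat.card {w : ZMod p // w ^ 2 = -(z.1 ^ 2 + z.2 ^ 2)} : ℤ)
        = quadraticChar (ZMod p) (-(z.1 ^ 2 + z.2 ^ 2)) + 1 := by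
    intro z
    rw [← quadraticChar_card_sqrts hchar, Set.toFinset_card, Nat.card_eq_fintype_card]
    rfl
  zify
  simp only [h1, Finset.sum_add_distrib, sum_quadraticChar_add_sq hp2]
  simp [ZMod.card, pow_two]

theorem numSqSolutions_three_prime_pow {p : ℕ} [hp : Fact p.Prime] (hp2 : p ≠ 2) (a : ℕ) :
    numSqSolutions 3 0 (p ^ (a + 2))
      = (p ^ (a + 1)) ^ 2 * (p ^ 2 - 1) + p ^ 3 * numSqSolutions 3 0 (p ^ a) := by
  have hd : p ∣ p ^ (a + 1 + 1) := dvd_pow_self p (Nat.succ_ne_zero _)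
  have hne : NeZero (p ^ (a + 1 + 1)) := ⟨pow_ne_zero _ hp.out.ne_zero⟩
  have h1 := card_primitive hp2 (a + 1) 2 hd
  rw [numSqSolutions_three_prime hp2] at h1
  have h2 : Nat.card {x : Fin 3 → ZMod (p ^ (a + 1 + 1)) //
      ∑ i, x i ^ 2 = 0 ∧ ∀ i, ZMod.castHom hd (ZMod p) (x i) = 0}
      = p ^ 3 * numSqSolutions 3 0 (p ^ a) := by
    have hd' : p ∣ p ^ 2 * p ^ a := ⟨p * p ^ a, by ring⟩
    rw [← card_imprimitive 3 hp.out.ne_zero (pow_ne_zero a hp.out.ne_zero) hd']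
    have hpow : p ^ (a + 1 + 1) = p ^ 2 * p ^ a := by ring
    clear h1 hne
    revert hd
    rw [hpow]
    intro hd
    rfl
  rw [numSqSolutions_zero, Nat.card_subtype_split _
    (fun x => ∀ i, ZMod.castHom hd (ZMod p) (x i) = 0), h2]
  rw [add_comm, ← h1]

/-! ### A divisor-sum formula for the number of solutions -/

/-- The coefficients `h` in `N₃(0, r) = r² ∑_{d² ∣ r} h d`: up to the factor `-2` at even `d`,
this is `φ(d) / d²`. The value at `0` is `0`. -/
noncomputable def squareCoeff (d : ℕ) : ℝ :=
  (if Even d then -2 else 1) * d.totient / (d : ℝ) ^ 2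

theorem squareCoeff_one : squareCoeff 1 = 1 := by simp [squareCoeff]

theorem squareCoeff_mul {m n : ℕ} (h : m.Coprime n) :
    squareCoeff (m * n) = squareCoeff m * squareCoeff n := by
  have he : (if Even (m * n) then (-2 : ℝ) else 1)
      = (if Even m then -2 else 1) * (if Even n then -2 else 1) := by
    by_cases hm : Even m
    · have hn : ¬ Even n := fun hn =>
        Nat.not_coprime_of_dvd_of_dvd one_lt_two hm.two_dvd hn.two_dvd h
      simp [hm, hn]
    · simp [Nat.even_mul, hm]
  rw [squareCoeff, squareCoeff, squareCoeff, Nat.totient_mul h, he]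
  push_cast
  ring

theorem squareCoeff_prime_mul {p m : ℕ} (hp : p.Prime) (h : p ∣ m) :
    squareCoeff (p * m) = squareCoeff m / p := by
  have he : Even (p * m) ↔ Even m := by
    rw [Nat.even_mul]
    exact ⟨fun H => H.elim (fun hp' => even_iff_two_dvd.2 (hp'.two_dvd.trans h)) id, Or.inr⟩
  have hp0 : (p : ℝ) ≠ 0 := by exact_mod_cast hp.ne_zero
  rw [squareCoeff, squareCoeff, Nat.totient_mul_of_prime_of_dvd hp h]
  simp only [he]
  push_cast
  rcases eq_or_ne m 0 with rfl | hm
  · simp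
  field_simp

theorem abs_squareCoeff_le (d : ℕ) : |squareCoeff d| ≤ 2 / d := by
  rcases Nat.eq_zero_or_pos d with rfl | hd
  · simp [squareCoeff]
  have hd' : (0 : ℝ) < d := by exact_mod_cast hd
  have h1 : (d.totient : ℝ) ≤ d := by exact_mod_cast Nat.totient_le d
  have h2 : |(if Even d then (-2 : ℝ) else 1)| ≤ 2 := by split_ifs <;> norm_num
  rw [squareCoeff, abs_div, abs_mul, abs_of_nonneg (Nat.cast_nonneg (α := ℝ) d.totient),
    abs_of_pos (pow_pos hd' 2), div_le_div_iff₀ (by positivity) hd']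
  calc _ ≤ 2 * (d : ℝ) * d := by gcongr
    _ = _ := by ring

open scoped Classical in
/-- The arithmetic function supported on squares with value `squareCoeff d` at `d²`. -/
noncomputable def squareCoeffFun : ArithmeticFunction ℝ :=
  ⟨fun n => if IsSquare n then squareCoeff n.sqrt else 0, by simp [squareCoeff]⟩

theorem squareCoeffFun_sq (d : ℕ) : squareCoeffFun (d * d) = squareCoeff d := by
  simp [squareCoeffFun, IsSquare.mul_self, Nat.sqrt_eq]

theorem squareCoeffFun_of_not_isSquare {n : ℕ} (h : ¬ IsSquare n) : squareCoeffFun n = 0 := by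
  simp [squareCoeffFun, h]

theorem Nat.Coprime.isSquare_of_mul {m n : ℕ} (h : m.Coprime n) (hs : IsSquare (m * n)) :
    IsSquare m := by
  obtain ⟨c, hc⟩ := hs
  obtain ⟨d, hd⟩ := exists_eq_pow_of_mul_eq_pow (k := 2) (c := c)
    (by rw [gcd_eq_nat_gcd, Nat.isUnit_iff]; exact h) (hc.trans (pow_two c).symm)
  exact ⟨d, hd.trans (pow_two d)⟩

theorem isMultiplicative_squareCoeffFun : squareCoeffFun.IsMultiplicative := by
  refine ⟨by rw [← mul_one 1, squareCoeffFun_sq, squareCoeff_one], fun {m n} h => ?_⟩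
  by_cases hm : IsSquare m
  · by_cases hn : IsSquare n
    · obtain ⟨a, rfl⟩ := hm
      obtain ⟨b, rfl⟩ := hn
      rw [mul_mul_mul_comm, squareCoeffFun_sq, squareCoeffFun_sq, squareCoeffFun_sq,
        squareCoeff_mul (Nat.Coprime.coprime_mul_left (Nat.Coprime.coprime_mul_left_right h))]
    · rw [squareCoeffFun_of_not_isSquare hn, mul_zero, squareCoeffFun_of_not_isSquare]
      exact fun hs => hn (h.symm.isSquare_of_mul (by rwa [mul_comm]))
  · rw [squareCoeffFun_of_not_isSquare hm, zero_mul, squareCoeffFun_of_not_isSquare]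
    exact fun hs => hm (h.isSquare_of_mul hs)

theorem squareCoeffFun_prime_sq_mul {p n : ℕ} (hp : p.Prime) (h : p ∣ n) :
    squareCoeffFun (p * p * n) = squareCoeffFun n / p := by
  by_cases hn : IsSquare n
  · obtain ⟨m, rfl⟩ := hn
    have hm : p ∣ m := (hp.dvd_mul.1 h).elim id id
    rw [mul_mul_mul_comm, squareCoeffFun_sq, squareCoeffFun_sq, squareCoeff_prime_mul hp hm]
  · rw [squareCoeffFun_of_not_isSquare hn, zero_div, squareCoeffFun_of_not_isSquare]
    rintro ⟨k, hk⟩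
    have hpk : p ∣ k := by
      have : p ∣ k * k := ⟨p * n, by rw [← hk]; ring⟩
      exact (hp.dvd_mul.1 this).elim id id
    obtain ⟨l, rfl⟩ := hpk
    refine hn ⟨l, Nat.eq_of_mul_eq_mul_left (mul_pos hp.pos hp.pos) ?_⟩
    rw [hk]; ring

open scoped ArithmeticFunction.zeta

/-- The arithmetic function `r ↦ N₃(0, r) / r²`, with value `0` at `0`. -/
noncomputable def solutionDensity : ArithmeticFunction ℝ :=
  ⟨fun r => (numSqSolutions 3 0 r : ℝ) / (r : ℝ) ^ 2, by simp⟩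

theorem solutionDensity_apply (r : ℕ) :
    solutionDensity r = (numSqSolutions 3 0 r : ℝ) / (r : ℝ) ^ 2 := rfl

theorem isMultiplicative_solutionDensity : solutionDensity.IsMultiplicative := by
  refine ⟨by simp [solutionDensity_apply, numSqSolutions_one], fun {m n} h => ?_⟩
  rw [solutionDensity_apply, solutionDensity_apply, solutionDensity_apply,
    numSqSolutions_mul 3 h]
  push_cast
  rw [mul_pow, mul_div_mul_comm]

theorem zeta_mul_squareCoeffFun_prime_pow {p : ℕ} (hp : p.Prime) (a : ℕ) :
    (ζ * squareCoeffFun : ArithmeticFunction ℝ) (p ^ (a + 2))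
      = 1 + squareCoeff p + ((ζ * squareCoeffFun : ArithmeticFunction ℝ) (p ^ a) - 1) / p := by
  have hnsq : squareCoeffFun p = 0 := squareCoeffFun_of_not_isSquare hp.prime.not_isSquare
  have h1 : squareCoeffFun 1 = 1 := isMultiplicative_squareCoeffFun.1
  have hstep : ∀ b, squareCoeffFun (p ^ (b + 1 + 1 + 1)) = squareCoeffFun (p ^ (b + 1)) / p := by
    intro b
    rw [← squareCoeffFun_prime_sq_mul hp (dvd_pow_self p (Nat.succ_ne_zero b)),
      show p ^ (b + 1 + 1 + 1) = p * p * p ^ (b + 1) by ring]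
  rw [ArithmeticFunction.coe_zeta_mul_apply, ArithmeticFunction.coe_zeta_mul_apply,
    Nat.sum_divisors_prime_pow hp, Nat.sum_divisors_prime_pow hp, Finset.sum_range_succ',
    Finset.sum_range_succ', Finset.sum_range_succ', Finset.sum_range_succ' _ a]
  simp only [hstep, zero_add, pow_zero, h1, pow_one, hnsq, ← Finset.sum_div]
  rw [show p ^ (1 + 1) = p * p by ring, squareCoeffFun_sq]
  ring

theorem solutionDensity_eq : solutionDensity = ζ * squareCoeffFun := by
  rw [isMultiplicative_solutionDensity.eq_iff_eq_on_prime_powers _ _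
    (ArithmeticFunction.isMultiplicative_zeta.natCast.mul isMultiplicative_squareCoeffFun)]
  intro p i hp
  have : Fact p.Prime := ⟨hp⟩
  have hp0 : (p : ℝ) ≠ 0 := by exact_mod_cast hp.ne_zero
  induction i using Nat.twoStepInduction with
  | zero =>
    rw [pow_zero, isMultiplicative_solutionDensity.1, ArithmeticFunction.coe_zeta_mul_apply]
    simp [isMultiplicative_squareCoeffFun.1]
  | one =>
    have : solutionDensity p = 1 := by
      rw [solutionDensity_apply, div_eq_one_iff_eq (pow_ne_zero 2 hp0)]
      rcases eq_or_ne p 2 with rfl | hp2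
      · rw [numSqSolutions_three_two]; norm_num
      · rw [numSqSolutions_three_prime hp2]; push_cast; rfl
    rw [pow_one, this, ArithmeticFunction.coe_zeta_mul_apply, hp.sum_divisors,
      isMultiplicative_squareCoeffFun.1,
      squareCoeffFun_of_not_isSquare hp.prime.not_isSquare, zero_add]
  | more a ih _ =>
    rw [zeta_mul_squareCoeffFun_prime_pow hp, ← ih, solutionDensity_apply, solutionDensity_apply]
    rcases eq_or_ne p 2 with rfl | hp2
    · rw [show 2 ^ (a + 2) = 2 ^ 2 * 2 ^ a by ring,
        numSqSolutions_three_four_mul (pow_ne_zero a two_ne_zero)]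
      simp only [squareCoeff, even_two, if_true, Nat.totient_two]
      push_cast
      field_simp
      ring
    · rw [numSqSolutions_three_prime_pow hp2]
      have hodd : ¬ Even p := fun he => hp2 (hp.even_iff.1 he)
      have h1 : 1 ≤ p ^ 2 := Nat.one_le_pow _ _ hp.pos
      simp only [squareCoeff, hodd, if_false, Nat.totient_prime hp]
      push_cast [h1, hp.one_le]
      field_simp
      ring

theorem numSqSolutions_three_eq_sum {r N : ℕ} (hr : r ∈ Finset.Icc 1 N) :
    (numSqSolutions 3 0 r : ℝ)
      = ∑ d ∈ Finset.Icc 1 N, if d ^ 2 ∣ r then squareCoeff d * (r : ℝ) ^ 2 else 0 := by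
  rw [Finset.mem_Icc] at hr
  have hr0 : (r : ℝ) ≠ 0 := by exact_mod_cast (show r ≠ 0 by omega)
  have h := congrArg (fun f : ArithmeticFunction ℝ => f r) solutionDensity_eq
  simp only [solutionDensity_apply, ArithmeticFunction.coe_zeta_mul_apply] at h
  rw [div_eq_iff (pow_ne_zero 2 hr0)] at h
  rw [h, ← Finset.sum_filter, ← Finset.sum_mul]
  congr 1
  symm
  refine Finset.sum_of_injOn (fun d => d * d) ?_ ?_ ?_ ?_
  · intro a _ b _ hab
    exact Nat.mul_self_inj.1 hab
  · intro d hd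
    simp only [Finset.coe_filter, Set.mem_ofPred_eq] at hd
    simp only [Finset.mem_coe, Nat.mem_divisors, ← pow_two]
    exact ⟨hd.2, by omega⟩
  · intro e he hne
    refine squareCoeffFun_of_not_isSquare fun hs => hne ?_
    obtain ⟨d, rfl⟩ := hs
    rw [Nat.mem_divisors] at he
    have hd0 : d ≠ 0 := by rintro rfl; simp at he
    refine ⟨d, ?_, rfl⟩
    simp only [Finset.coe_filter, Set.mem_ofPred_eq, Finset.mem_Icc, pow_two]
    refine ⟨⟨by omega, ?_⟩, he.1⟩
    have := Nat.le_of_dvd (by omega) he.1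
    nlinarith [Nat.pos_of_ne_zero hd0]
  · intro d _
    exact (squareCoeffFun_sq d).symm

/-! ### The singular series -/

theorem summable_totient_div_pow_four : Summable fun n : ℕ => (n.totient : ℝ) / (n : ℝ) ^ 4 := by
  refine Summable.of_nonneg_of_le (fun n => by positivity) (fun n => ?_)
    (Real.summable_one_div_nat_pow.2 (by norm_num : 1 < 3))
  rcases Nat.eq_zero_or_pos n with rfl | hn
  · simp
  have h1 : (n.totient : ℝ) ≤ n := by exact_mod_cast Nat.totient_le n
  have hn' : (0 : ℝ) < n := by exact_mod_cast hn
  rw [div_le_div_iff₀ (by positivity) (by positivity)]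
  calc _ ≤ (n : ℝ) * n ^ 3 := by gcongr
    _ = _ := by ring

/-- The Dirichlet series of `φ * 1 = id` at `4`. -/
theorem tsum_totient_div_pow_four :
    (∑' n : ℕ, (n.totient : ℝ) / (n : ℝ) ^ 4) * (∑' n : ℕ, 1 / (n : ℝ) ^ 4)
      = ∑' n : ℕ, 1 / (n : ℝ) ^ 3 := by
  let f : ArithmeticFunction ℂ := ⟨fun n => n.totient, by simp⟩
  let z : ArithmeticFunction ℂ := (ζ : ArithmeticFunction ℕ)
  have hfz : ∀ n, (f * z) n = n := by
    intro n
    rw [ArithmeticFunction.coe_mul_zeta_apply]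
    change ∑ i ∈ n.divisors, (i.totient : ℂ) = n
    exact_mod_cast congrArg (Nat.cast (R := ℂ)) (Nat.sum_totient n)
  have hf : LSeries.term (fun n => f n) 4
      = fun n : ℕ => (((n.totient : ℝ) / (n : ℝ) ^ 4 : ℝ) : ℂ) := by
    funext n
    rcases eq_or_ne n 0 with rfl | hn
    · simp
    · simp [hn, f]
  have hz : LSeries.term (fun n => z n) 4 = fun n : ℕ => ((1 / (n : ℝ) ^ 4 : ℝ) : ℂ) := by
    funext n
    rcases eq_or_ne n 0 with rfl | hn
    · simp
    · simp [hn, z, ArithmeticFunction.natCoe_apply]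
  have hid : LSeries.term (fun n => (f * z) n) 4
      = fun n : ℕ => ((1 / (n : ℝ) ^ 3 : ℝ) : ℂ) := by
    funext n
    rcases eq_or_ne n 0 with rfl | hn
    · simp
    · have hn' : (n : ℂ) ≠ 0 := by exact_mod_cast hn
      rw [LSeries.term_def, if_neg hn, hfz]
      push_cast
      rw [Complex.cpow_ofNat]
      field_simp
  have h := ArithmeticFunction.LSeries_mul' (f := f) (g := z) (s := 4)
    (by rw [LSeriesSummable, hf]; exact_mod_cast summable_totient_div_pow_four)
    (by
      rw [LSeriesSummable, hz]
      exact_mod_cast Real.summable_one_div_nat_pow.2 (by norm_num : 1 < 4))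
  rw [LSeries, LSeries, LSeries, hf, hz, hid, ← Complex.ofReal_tsum,
    ← Complex.ofReal_tsum, ← Complex.ofReal_tsum, ← Complex.ofReal_mul] at h
  exact (Complex.ofReal_injective h).symm

theorem tsum_squareCoeff_div_sq :
    ∑' d : ℕ, squareCoeff d / (d : ℝ) ^ 2 = 72 * (riemannZeta 3).re / Real.pi ^ 4 := by
  have hz3 : (riemannZeta 3).re = ∑' n : ℕ, 1 / (n : ℝ) ^ 3 := by
    have := zeta_nat_eq_tsum_of_gt_one (k := 3) (by norm_num)
    have h2 : riemannZeta 3 = ((∑' n : ℕ, 1 / (n : ℝ) ^ 3 : ℝ) : ℂ) := by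
      push_cast; exact_mod_cast this
    rw [h2, Complex.ofReal_re]
  have hz4 : ∑' n : ℕ, 1 / (n : ℝ) ^ 4 = Real.pi ^ 4 / 90 := hasSum_zeta_four.tsum_eq
  have hA := tsum_totient_div_pow_four
  have hs := summable_totient_div_pow_four
  set f : ℕ → ℝ := fun n => (n.totient : ℝ) / (n : ℝ) ^ 4 with hf
  have hse : Summable fun n => f (2 * n) :=
    hs.comp_injective (i := fun n => 2 * n) fun a b h => by simpa using h
  have hso : Summable fun n => f (2 * n + 1) :=
    hs.comp_injective (i := fun n => 2 * n + 1) fun a b h => by simpa using h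
  have hsplit := tsum_even_add_odd hse hso
  -- `φ(2m) = φ(m)` or `2 φ(m)` according to the parity of `m`
  have heo : ∀ n, f (2 * (2 * n + 1)) = f (2 * n + 1) / 16 := by
    intro n
    simp only [hf]
    rw [Nat.totient_mul (by simp)]
    push_cast
    rw [Nat.totient_two, mul_pow, Nat.cast_one, one_mul, ← div_div, div_right_comm]
    norm_num
  have hee : ∀ n, f (2 * (2 * n)) = f (2 * n) / 8 := by
    intro n
    simp only [hf]
    rw [Nat.totient_mul_of_prime_of_dvd Nat.prime_two ⟨n, rfl⟩]
    push_cast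
    ring
  have hrec := tsum_even_add_odd (f := fun n => f (2 * n))
    (hse.comp_injective (i := fun n => 2 * n) fun a b h => by simpa using h)
    (hse.comp_injective (i := fun n => 2 * n + 1) fun a b h => by simpa using h)
  -- for the sums `E`, `O` of `f` over even and odd indices this reads `E / 8 + O / 16 = E`
  simp only [heo, hee, tsum_div_const] at hrec
  have he : ∀ n, squareCoeff (2 * n) / ((2 * n : ℕ) : ℝ) ^ 2 = -2 * f (2 * n) := by
    intro n
    simp only [squareCoeff, hf, even_two_mul, if_true]
    rw [mul_div_assoc, mul_div_assoc, div_div, ← pow_add]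
  have ho : ∀ n, squareCoeff (2 * n + 1) / ((2 * n + 1 : ℕ) : ℝ) ^ 2 = f (2 * n + 1) := by
    intro n
    have : ¬ Even (2 * n + 1) := by simp
    simp only [squareCoeff, hf, this, if_false]
    rw [one_mul, div_div, ← pow_add]
  rw [← tsum_even_add_odd (f := fun d : ℕ => squareCoeff d / (d : ℝ) ^ 2)
    (by simp only [he]; exact hse.mul_left _) (by simp only [ho]; exact hso)]
  simp only [he, ho, tsum_mul_left]
  rw [hz3, ← hA, hz4]
  have hpi := Real.pi_ne_zero
  field_simp
  linarith

/-! ### Summation over the moduli -/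

theorem sum_sq_Icc_eq (n : ℕ) :
    ∑ m ∈ Finset.Icc 1 n, (m : ℝ) ^ 2 = n * (n + 1) * (2 * n + 1) / 6 := by
  induction n with
  | zero => simp
  | succ n ih =>
    rw [Finset.sum_Icc_succ_top (by omega), ih]
    push_cast
    ring

theorem abs_sum_sq_sub_le {y : ℝ} (hy : 0 < y) :
    |∑ m ∈ Finset.Icc 1 ⌊y⌋₊, (m : ℝ) ^ 2 - y ^ 3 / 3| ≤ 2 * y ^ 2 := by
  have h1 : (⌊y⌋₊ : ℝ) ≤ y := Nat.floor_le hy.le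
  have h2 : y < ⌊y⌋₊ + 1 := Nat.lt_floor_add_one y
  rw [sum_sq_Icc_eq]
  rcases Nat.eq_zero_or_pos ⌊y⌋₊ with h0 | h0
  · rw [h0] at h2 ⊢
    norm_num at h2 ⊢
    rw [abs_of_pos (by positivity)]
    nlinarith [pow_pos hy 2]
  have hn : (1 : ℝ) ≤ ⌊y⌋₊ := by exact_mod_cast h0
  set n : ℝ := (⌊y⌋₊ : ℝ)
  have hn3 : n ^ 3 ≤ y ^ 3 := by gcongr
  have hn2 : n ^ 2 ≤ y ^ 2 := by gcongr
  have hy3 : y ^ 3 ≤ (n + 1) ^ 3 := by gcongr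
  rw [abs_le]
  constructor <;> nlinarith

/-- The error term is uniform in `d`: for `d² > x` the sum is empty, and the main term itself is
at most `x² / 3`. -/
theorem abs_sum_sq_dvd_sub_le {x : ℝ} (hx : 0 < x) {d : ℕ} (hd : 1 ≤ d) :
    |∑ r ∈ Finset.Icc 1 ⌊x⌋₊, (if d ^ 2 ∣ r then (r : ℝ) ^ 2 else 0) - x ^ 3 / (3 * (d : ℝ) ^ 2)|
      ≤ 2 * x ^ 2 := by
  have hd0 : (0 : ℝ) < d := by exact_mod_cast hd
  have hsum : ∑ r ∈ Finset.Icc 1 ⌊x⌋₊, (if d ^ 2 ∣ r then (r : ℝ) ^ 2 else 0)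
      = (d : ℝ) ^ 4 * ∑ m ∈ Finset.Icc 1 ⌊x / (d : ℝ) ^ 2⌋₊, (m : ℝ) ^ 2 := by
    have hfl : ⌊x / (d : ℝ) ^ 2⌋₊ = ⌊x⌋₊ / d ^ 2 := by
      rw [← Nat.floor_div_natCast]; push_cast; rfl
    have hdp : 0 < d ^ 2 := by positivity
    rw [← Finset.sum_filter, Finset.mul_sum, hfl]
    symm
    refine Finset.sum_bij (fun m _ => d ^ 2 * m) ?_ ?_ ?_ ?_
    · intro m hm
      rw [Finset.mem_Icc, Nat.le_div_iff_mul_le hdp] at hm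
      rw [Finset.mem_filter, Finset.mem_Icc, mul_comm]
      exact ⟨⟨Nat.mul_pos hm.1 hdp, hm.2⟩, dvd_mul_left _ _⟩
    · intro a _ b _ h
      exact Nat.eq_of_mul_eq_mul_left hdp h
    · intro r hr
      rw [Finset.mem_filter, Finset.mem_Icc] at hr
      obtain ⟨⟨h1, h2⟩, m, rfl⟩ := hr
      refine ⟨m, ?_, rfl⟩
      rw [Finset.mem_Icc, Nat.le_div_iff_mul_le hdp, mul_comm m]
      exact ⟨Nat.pos_of_mul_pos_left h1, h2⟩
    · intro m _
      push_cast
      ring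
  have h := abs_sum_sq_sub_le (y := x / (d : ℝ) ^ 2) (by positivity)
  rw [hsum]
  have hfac : (d : ℝ) ^ 4 * ∑ m ∈ Finset.Icc 1 ⌊x / (d : ℝ) ^ 2⌋₊, (m : ℝ) ^ 2
      - x ^ 3 / (3 * (d : ℝ) ^ 2)
      = (d : ℝ) ^ 4 * (∑ m ∈ Finset.Icc 1 ⌊x / (d : ℝ) ^ 2⌋₊, (m : ℝ) ^ 2
        - (x / (d : ℝ) ^ 2) ^ 3 / 3) := by
    field_simp
  rw [hfac, abs_mul, abs_of_pos (by positivity : (0 : ℝ) < (d : ℝ) ^ 4)]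
  calc _ ≤ (d : ℝ) ^ 4 * (2 * (x / (d : ℝ) ^ 2) ^ 2) := by gcongr
    _ = 2 * x ^ 2 := by field_simp

theorem abs_squareCoeff_div_sq_le (d : ℕ) :
    |squareCoeff d / (d : ℝ) ^ 2| ≤ 2 * (1 / (d : ℝ) ^ 3) := by
  rw [abs_div, abs_of_nonneg (by positivity : (0 : ℝ) ≤ (d : ℝ) ^ 2)]
  calc _ ≤ 2 / (d : ℝ) / (d : ℝ) ^ 2 := by gcongr; exact abs_squareCoeff_le d
    _ = 2 * (1 / (d : ℝ) ^ 3) := by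
      rw [div_div, ← pow_succ']; ring

theorem summable_squareCoeff_div_sq : Summable fun d : ℕ => squareCoeff d / (d : ℝ) ^ 2 :=
  Summable.of_norm_bounded ((Real.summable_one_div_nat_pow.2 (by norm_num : 1 < 3)).mul_left 2)
    abs_squareCoeff_div_sq_le

/-- The tail of the singular series beyond `N` is `O(1 / N)`. -/
theorem abs_tsum_squareCoeff_sub_sum_le (N : ℕ) :
    |∑ d ∈ Finset.Icc 1 N, squareCoeff d / (d : ℝ) ^ 2 - ∑' d : ℕ, squareCoeff d / (d : ℝ) ^ 2|
      ≤ 2 * (∑' d : ℕ, 1 / (d : ℝ) ^ 2) / (N + 1) := by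
  have hs := summable_squareCoeff_div_sq
  have hs2 : Summable fun d : ℕ => 1 / (d : ℝ) ^ 2 :=
    Real.summable_one_div_nat_pow.2 (by norm_num)
  have hs2' := (summable_nat_add_iff (N + 1)).2 hs2
  have hsum : ∑ d ∈ Finset.Icc 1 N, squareCoeff d / (d : ℝ) ^ 2
      = ∑ d ∈ Finset.range (N + 1), squareCoeff d / (d : ℝ) ^ 2 := by
    rw [Finset.range_eq_Ico, Finset.sum_eq_sum_Ico_succ_bot (Nat.succ_pos N)]
    simp [squareCoeff]
    rfl
  rw [hsum, ← hs.sum_add_tsum_nat_add (N + 1), sub_add_cancel_left, abs_neg]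
  have hterm : ∀ d : ℕ, |squareCoeff (d + (N + 1)) / ((d + (N + 1) : ℕ) : ℝ) ^ 2|
      ≤ 2 / (N + 1) * (1 / ((d + (N + 1) : ℕ) : ℝ) ^ 2) := by
    intro d
    refine (abs_squareCoeff_div_sq_le _).trans ?_
    have hle : (N + 1 : ℝ) ≤ ((d + (N + 1) : ℕ) : ℝ) := by
      push_cast; linarith [Nat.cast_nonneg (α := ℝ) d]
    have hN : (0 : ℝ) < N + 1 := by positivity
    have hpos : (0 : ℝ) < ((d + (N + 1) : ℕ) : ℝ) := hN.trans_le hle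
    rw [div_mul_div_comm, mul_one, mul_one_div]
    gcongr
    rw [pow_succ' _ 2]
    gcongr
  have htail : ∑' d : ℕ, 1 / ((d + (N + 1) : ℕ) : ℝ) ^ 2 ≤ ∑' d : ℕ, 1 / (d : ℝ) ^ 2 := by
    rw [← hs2.sum_add_tsum_nat_add (N + 1)]
    exact le_add_of_nonneg_left (Finset.sum_nonneg fun _ _ => by positivity)
  rw [← Real.norm_eq_abs]
  refine (tsum_of_norm_bounded (hs2'.mul_left _).hasSum hterm).trans ?_
  rw [tsum_mul_left, mul_div_right_comm]
  exact mul_le_mul_of_nonneg_left htail (by positivity)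

theorem sum_abs_squareCoeff_le {x : ℝ} (hx : 1 ≤ x) :
    ∑ d ∈ Finset.Icc 1 ⌊x⌋₊, |squareCoeff d| ≤ 2 * (1 + Real.log x) := by
  calc _ ≤ ∑ d ∈ Finset.Icc 1 ⌊x⌋₊, 2 * ((d : ℝ))⁻¹ :=
        Finset.sum_le_sum fun d _ => (abs_squareCoeff_le d).trans_eq (div_eq_mul_inv _ _)
    _ = 2 * (harmonic ⌊x⌋₊ : ℝ) := by
        rw [harmonic_eq_sum_Icc, ← Finset.mul_sum]; push_cast; rfl
    _ ≤ _ := by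
        gcongr
        refine (harmonic_le_one_add_log _).trans ?_
        have : (0 : ℝ) < ⌊x⌋₊ := by exact_mod_cast Nat.floor_pos.2 hx
        gcongr
        exact Nat.floor_le (by linarith)

theorem abs_sum_numSqSolutions_three_sub_le {x : ℝ} (hx : 1 ≤ x) :
    |∑ r ∈ Finset.Icc 1 ⌊x⌋₊, (numSqSolutions 3 0 r : ℝ)
        - 24 * (riemannZeta 3).re / Real.pi ^ 4 * x ^ 3|
      ≤ 4 * x ^ 2 * (1 + Real.log x) + (∑' d : ℕ, 1 / (d : ℝ) ^ 2) * x ^ 2 := by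
  have hx0 : 0 < x := by linarith
  set N := ⌊x⌋₊
  set T : ℕ → ℝ := fun d => ∑ r ∈ Finset.Icc 1 N, (if d ^ 2 ∣ r then (r : ℝ) ^ 2 else 0) with hT
  have h1 : ∑ r ∈ Finset.Icc 1 N, (numSqSolutions 3 0 r : ℝ)
      = ∑ d ∈ Finset.Icc 1 N, squareCoeff d * T d := by
    rw [Finset.sum_congr rfl fun r hr => numSqSolutions_three_eq_sum hr, Finset.sum_comm]
    refine Finset.sum_congr rfl fun d _ => ?_
    rw [hT, Finset.mul_sum]
    simp only [mul_ite, mul_zero]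
  have h2 : ∑ r ∈ Finset.Icc 1 N, (numSqSolutions 3 0 r : ℝ)
        - 24 * (riemannZeta 3).re / Real.pi ^ 4 * x ^ 3
      = ∑ d ∈ Finset.Icc 1 N, squareCoeff d * (T d - x ^ 3 / (3 * (d : ℝ) ^ 2))
        + x ^ 3 / 3 * (∑ d ∈ Finset.Icc 1 N, squareCoeff d / (d : ℝ) ^ 2
          - ∑' d : ℕ, squareCoeff d / (d : ℝ) ^ 2) := by
    have h3 : ∑ d ∈ Finset.Icc 1 N, squareCoeff d * (T d - x ^ 3 / (3 * (d : ℝ) ^ 2))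
        = ∑ d ∈ Finset.Icc 1 N, squareCoeff d * T d
          - x ^ 3 / 3 * ∑ d ∈ Finset.Icc 1 N, squareCoeff d / (d : ℝ) ^ 2 := by
      rw [Finset.mul_sum, ← Finset.sum_sub_distrib]
      refine Finset.sum_congr rfl fun d _ => ?_
      ring
    rw [h1, h3, tsum_squareCoeff_div_sq]
    ring
  rw [h2]
  refine (abs_add_le _ _).trans (add_le_add ?_ ?_)
  · calc _ ≤ ∑ d ∈ Finset.Icc 1 N, |squareCoeff d * (T d - x ^ 3 / (3 * (d : ℝ) ^ 2))| :=
          Finset.abs_sum_le_sum_abs _ _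
      _ ≤ ∑ d ∈ Finset.Icc 1 N, |squareCoeff d| * (2 * x ^ 2) := by
          refine Finset.sum_le_sum fun d hd => ?_
          rw [abs_mul]
          gcongr
          exact abs_sum_sq_dvd_sub_le hx0 (Finset.mem_Icc.1 hd).1
      _ = (∑ d ∈ Finset.Icc 1 N, |squareCoeff d|) * (2 * x ^ 2) := by rw [Finset.sum_mul]
      _ ≤ 2 * (1 + Real.log x) * (2 * x ^ 2) := by
          gcongr
          exact sum_abs_squareCoeff_le hx
      _ = _ := by ring
  · have hC : 0 ≤ ∑' d : ℕ, 1 / (d : ℝ) ^ 2 := tsum_nonneg fun _ => by positivity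
    have hN : x < N + 1 := Nat.lt_floor_add_one x
    rw [abs_mul, abs_of_pos (by positivity : 0 < x ^ 3 / 3)]
    calc _ ≤ x ^ 3 / 3 * (2 * (∑' d : ℕ, 1 / (d : ℝ) ^ 2) / (N + 1)) := by
          gcongr
          exact abs_tsum_squareCoeff_sub_sum_le N
      _ ≤ x ^ 3 / 3 * (2 * (∑' d : ℕ, 1 / (d : ℝ) ^ 2) / x) := by gcongr
      _ = 2 / 3 * ((∑' d : ℕ, 1 / (d : ℝ) ^ 2) * x ^ 2) := by field_simp
      _ ≤ _ := by nlinarith [mul_nonneg hC (sq_nonneg x)]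

theorem proposition8p11 :
    (fun x : ℝ =>
        (∑ r ∈ Finset.Icc 1 ⌊x⌋₊, (numSqSolutions 3 0 r : ℝ))
          - 24 * (riemannZeta 3).re / Real.pi ^ 4 * x ^ 3)
      =O[Filter.atTop] (fun x : ℝ => x ^ 2 * Real.log x) := by
  refine Asymptotics.IsBigO.of_bound (8 + ∑' d : ℕ, 1 / (d : ℝ) ^ 2) ?_
  filter_upwards [Filter.eventually_ge_atTop (Real.exp 1)] with x hx
  have hx1 : 1 ≤ x := (Real.one_le_exp zero_le_one).trans hx
  have hlog : 1 ≤ Real.log x := (Real.le_log_iff_exp_le (by linarith)).2 hx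
  have hC : 0 ≤ ∑' d : ℕ, 1 / (d : ℝ) ^ 2 := tsum_nonneg fun _ => by positivity
  rw [Real.norm_eq_abs, Real.norm_of_nonneg (by positivity)]
  refine (abs_sum_numSqSolutions_three_sub_le hx1).trans ?_
  have hx2 : x ^ 2 ≤ x ^ 2 * Real.log x := le_mul_of_one_le_right (sq_nonneg x) hlog
  nlinarith [mul_le_mul_of_nonneg_left hx2 hC]
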